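/- Let $R$ be a semilocal principal ideal domain in which $2$ is invertible, and let $K$ be its field of fractions. A quadratic form over $R$ is a pair $(V,q)$ with $V$ a finitely generated projective (equivalently, free of finite rank) $R$-module and $q : V \to R$ a quadratic form, with polar form $b_q(v,w) = q(v+w)-q(v)-q(w)$. For a maximal ideal $\mathfrak{m}$ of $R$ with residue field $\kappa(\mathfrak{m})$, let $\mathrm{rad}(q_{\mathfrak m})$ be the kernel of the map $V\otimes_R \kappa(\mathfrak{m}) \to \mathrm{Hom}_{\kappa(\mathfrak m)}(V\otimes_R \kappa(\mathfrak{m}),\kappa(\mathfrak{m}))$ induced by $b_q$. We say that $q$ has simple degeneration if $\dim_{\kappa(\mathfrak{m})} \mathrm{rad}(q_{\mathfrak m}) \le 1$ for every maximal ideal $\mathfrak{m}$ of $R$; it then has multiplicity one if for every maximal ideal $\mathfrak m$ with $\mathrm{rad}(q_{\mathfrak m}) \ne 0$ there is a diagonalization $$ q|_{R_{\mathfrak m}} \cong \langle u_1,\dots,u_{r-1},u_r\pi\rangle $$ over the local ring $R_{\mathfrak m}$ with units $u_i \in R_{\mathfrak m}^\times$ and $\pi$ a uniformizer of $R_{\mathfrak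 m}$. Corollary. If two quadratic forms $q$ and $q'$ over $R$, both with simple degeneration and of multiplicity one, become isometric over $K$, then they are isometric over $R$. -/

import Mathlib

open scoped TensorProduct

noncomputable section

namespace QuadraticForm

variable {R : Type*} [CommRing R] [Invertible (2 : R)]
variable {V : Type*} [AddCommGroup V] [Module R V]

/-- The radical of the fiber of `q` at a prime `p`: the kernel of the adjoint map
`v ↦ b_q(v, ·)` of the quadratic form induced by `q` on `κ(p) ⊗ V`,
where `b_q(v, w) = q(v + w) - q(v) - q(w)`. -/
def fiberRadical (q : QuadraticForm R V) (p : Ideal R) [p.IsPrime] :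
    Submodule p.ResidueField (p.ResidueField ⊗[R] V) :=
  LinearMap.ker (QuadraticMap.polarBilin (q.baseChange p.ResidueField))

/-- `q` has simple degeneration: at every closed point of `Spec R` the radical of the fiber
of `q` has dimension at most one over the residue field. -/
def HasSimpleDegeneration (q : QuadraticForm R V) : Prop :=
  ∀ (m : Ideal R) [m.IsMaximal], Module.finrank m.ResidueField (q.fiberRadical m) ≤ 1

/-- Over the local ring `R_p` the form `q` has a diagonalization
`⟨u₁, …, uₙ, w π ^ e⟩` with `uᵢ` and `w` units and `π` a uniformizer of `R_p`. -/
def HasMultiplicityAt (q : QuadraticForm R V) (p : Ideal R) [p.IsPrime] (e : ℕ) : Prop :=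
  ∃ (n : ℕ) (u : Fin n → (Localization.AtPrime p)ˣ) (w : (Localization.AtPrime p)ˣ)
    (π : Localization.AtPrime p), Irreducible π ∧
      (q.baseChange (Localization.AtPrime p)).Equivalent
        (QuadraticMap.weightedSumSquares (Localization.AtPrime p)
          (Fin.snoc (α := fun _ : Fin (n + 1) => Localization.AtPrime p)
            (fun i : Fin n => (u i : Localization.AtPrime p))
            ((w : Localization.AtPrime p) * π ^ e)))

/-- Along every closed point at which the fiber of `q` is degenerate, `q` has multiplicity one. -/
def HasMultiplicityOne (q : QuadraticForm R V) : Prop :=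
  ∀ (m : Ideal R) [m.IsMaximal], q.fiberRadical m ≠ ⊥ → q.HasMultiplicityAt m 1

end QuadraticForm

end

/-!
A form with simple degeneration of multiplicity one is one whose discriminant is squarefree. What
the proof needs of this is collected in `QuadraticForm.HasReducedDegeneration`: modulo each maximal
ideal `m` the radical has dimension at most one, and `q` takes no value in `m ^ 2` on a vector of
the radical that is nonzero modulo `m`. This property passes to the orthogonal complement of a
vector of unit norm, so the classification can proceed by induction on the rank, for two lattices
`L` and `L'` in the same quadratic space `W` over `K`.

In rank at least two, the Chinese remainder theorem gives a vector `x` of `L` with `q x = u` a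
unit (`exists_isUnit_apply`). The key point is that `u` is then represented by `L'` as well
(`exists_apply_eq`). Indeed `L' ⊗ K` represents `u` by a vector `w = z / s` in lowest terms. At a
maximal ideal containing `s`, the value `q' z = s ^ 2 * u` lies in `m ^ 2`, so that `z` is not in
the radical modulo `m`. Hence some `t` in `L'` makes `s * q' (w + t)` a unit at all maximal ideals
at once, and for such `t` the reflection in `w + t` moves `w` into `L'`. Once both lattices contain
a vector of norm `u`, a reflection of `W` makes these vectors equal (`exists_isometry_apply_eq`,
Witt cancellation), and their orthogonal complements are lattices in the same quadratic space
(`IsLattice.exists_orthogonal`). In rank one, two generators of norms `a` and `b` with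
`s ^ 2 * a = c ^ 2 * b` in lowest terms have `s` and `c` units, as `a` and `b` have no square
factor.
-/

open QuadraticMap

universe u v w

namespace QuadraticForm

/-! ### Representing units -/

section Reduced

variable {R : Type*} [CommRing R] {L : Type*} [AddCommGroup L] [Module R L]

/-- The integral substance of simple degeneration of multiplicity one, expressed without passing
to residue fields or localizations: at every maximal ideal `m`, two vectors in the radical of
`q` modulo `m` are linearly dependent modulo `m`, and `q` does not take values in `m ^ 2` on
vectors which are nonzero modulo `m` and lie in that radical. -/
structure HasReducedDegeneration (q : QuadraticForm R L) : Prop where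
  dependent : ∀ (m : Ideal R) [m.IsMaximal] (x y : L), (∀ v, polar q x v ∈ m) →
    (∀ v, polar q y v ∈ m) → ∃ a b : R, (a ∉ m ∨ b ∉ m) ∧ a • x + b • y ∈ m • (⊤ : Submodule R L)
  not_mem_sq : ∀ (m : Ideal R) [m.IsMaximal] (x : L), x ∉ m • (⊤ : Submodule R L) →
    (∀ v, polar q x v ∈ m) → q x ∉ m ^ 2

theorem linearMap_apply_mem_of_mem_smul_top (f : L →ₗ[R] R) {I : Ideal R} {y : L}
    (hy : y ∈ I • (⊤ : Submodule R L)) : f y ∈ I := by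
  refine Submodule.smul_induction_on hy (fun r hr n _ => ?_) (fun a b ha hb => ?_)
  · rw [f.map_smul]
    exact I.mul_mem_right _ hr
  · rw [f.map_add]
    exact I.add_mem ha hb

theorem polar_mem_of_mem_smul_top (q : QuadraticForm R L) {I : Ideal R} (x : L) {y : L}
    (hy : y ∈ I • (⊤ : Submodule R L)) : polar q x y ∈ I :=
  linearMap_apply_mem_of_mem_smul_top (q.polarBilin x) hy

theorem apply_mem_of_mem_smul_top [Invertible (2 : R)] (q : QuadraticForm R L) {I : Ideal R} {y : L}
    (hy : y ∈ I • (⊤ : Submodule R L)) : q y ∈ I := by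
  have h : q y = ⅟(2 : R) * polar q y y := by
    rw [polar_self, two_nsmul, ← two_mul, invOf_mul_cancel_left]
  exact h ▸ I.mul_mem_left _ (polar_mem_of_mem_smul_top q y hy)

theorem apply_add_smul (q : QuadraticForm R L) (x y : L) (c : R) :
    q (x + c • y) = q x + c * polar q x y + c ^ 2 * q y := by
  rw [QuadraticMap.map_add q, QuadraticMap.map_smul, polar_smul_right, smul_eq_mul, smul_eq_mul]
  ring

/-- The Chinese remainder theorem for the finitely many maximal ideals of a semilocal ring, in a
module. -/
theorem exists_forall_sub_mem_smul_top [Finite (MaximalSpectrum R)] (t : MaximalSpectrum R → L) :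
    ∃ y : L, ∀ m : MaximalSpectrum R, y - t m ∈ m.asIdeal • (⊤ : Submodule R L) := by
  classical
  have := Fintype.ofFinite (MaximalSpectrum R)
  have hcop : Pairwise (Function.onFun IsCoprime fun m : MaximalSpectrum R => m.asIdeal) := by
    intro m n hmn
    have := m.isMaximal
    have := n.isMaximal
    exact Ideal.isCoprime_of_isMaximal fun h => hmn (MaximalSpectrum.ext h)
  choose e he using fun i : MaximalSpectrum R =>
    Ideal.exists_forall_sub_mem_ideal hcop (Pi.single i (1 : R))
  refine ⟨∑ i, e i • t i, fun m => ?_⟩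
  have h : ∑ i, e i • t i - t m =
      ∑ i, (e i - (Pi.single i (1 : R) : MaximalSpectrum R → R) m) • t i := by
    simp [sub_smul, Finset.sum_sub_distrib, Pi.single_apply]
  rw [h]
  exact Submodule.sum_mem _ fun i _ => Submodule.smul_mem_smul (he i m) Submodule.mem_top

/-- A function which is well defined modulo each maximal ideal of a semilocal ring and which
modulo each of them takes a nonzero value takes a unit value. -/
theorem exists_isUnit_of_forall_exists_notMem [Finite (MaximalSpectrum R)] (f : L → R)
    (hf : ∀ (m : Ideal R) [m.IsMaximal] (x d : L), d ∈ m • (⊤ : Submodule R L) →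
      f (x + d) - f x ∈ m)
    (h : ∀ (m : Ideal R) [m.IsMaximal], ∃ x, f x ∉ m) : ∃ x, IsUnit (f x) := by
  choose t ht using fun m : MaximalSpectrum R => have := m.isMaximal; h m.asIdeal
  obtain ⟨y, hy⟩ := exists_forall_sub_mem_smul_top t
  refine ⟨y, by_contra fun hu => ?_⟩
  obtain ⟨m, hm, hmem⟩ := exists_max_ideal_of_mem_nonunits hu
  have h1 := hf m (t ⟨m, hm⟩) _ (hy ⟨m, hm⟩)
  rw [add_sub_cancel] at h1
  exact ht ⟨m, hm⟩ ((Submodule.sub_mem_iff_right m hmem).1 h1)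

/-- If `q` vanished modulo a maximal ideal, then so would its polar form, and the radical there would
have dimension at least two. -/
theorem exists_isUnit_apply [Nontrivial R] [Finite (MaximalSpectrum R)] [Invertible (2 : R)]
    [Module.Free R L] [Module.Finite R L] {q : QuadraticForm R L} (hq : q.HasReducedDegeneration)
    (hL : 1 < Module.finrank R L) : ∃ x, IsUnit (q x) := by
  refine exists_isUnit_of_forall_exists_notMem q (fun m _ x d hd => ?_) (fun m hm => ?_)
  · rw [QuadraticMap.map_add q]
    have := m.add_mem (apply_mem_of_mem_smul_top q hd) (polar_mem_of_mem_smul_top q x hd)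
    convert this using 1
    ring
  · by_contra! h
    have hpol : ∀ x y, polar q x y ∈ m := fun x y => by
      rw [polar]
      exact m.sub_mem (m.sub_mem (h _) (h _)) (h _)
    let b := Module.finBasis R L
    obtain ⟨α, β, hαβ, hmem⟩ := hq.dependent m (b ⟨0, by lia⟩) (b ⟨1, hL⟩) (hpol _) (hpol _)
    have h0 := linearMap_apply_mem_of_mem_smul_top (b.coord ⟨0, by lia⟩) hmem
    have h1 := linearMap_apply_mem_of_mem_smul_top (b.coord ⟨1, hL⟩) hmem
    simp at h0 h1
    exact hαβ.elim (fun h => h h0) (fun h => h h1)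

/-- A unit represented by `q` over the fraction field is represented by `q`. The vector `z` is the
numerator and `s` the denominator of a vector `w = z / s` with `q w = u`, in lowest terms. -/
theorem exists_apply_eq [Finite (MaximalSpectrum R)] [Invertible (2 : R)]
    {q : QuadraticForm R L} (hq : q.HasReducedDegeneration) {z : L} {s u : R} (hu : IsUnit u)
    (hz : q z = s ^ 2 * u)
    (hs : ∀ (m : Ideal R) [m.IsMaximal], s ∈ m → z ∉ m • (⊤ : Submodule R L)) :
    ∃ x, q x = u := by
  -- `D t / s` is the value of `q` at `w + t`. The reflection in `w + t` maps `w` to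
  -- `-t - (u - q t) / q (w + t) • (w + t)`, and `(w + t) / q (w + t) = (z + s • t) / D t` is
  -- integral as soon as `D t` is a unit.
  let D : L → R := fun t => s * u + polar q z t + s * q t
  obtain ⟨t, d, hd⟩ : ∃ t, IsUnit (D t) := by
    refine exists_isUnit_of_forall_exists_notMem D (fun m _ x d hd => ?_) (fun m hm => ?_)
    · have h1 := polar_mem_of_mem_smul_top q z hd
      have h2 := polar_mem_of_mem_smul_top q x hd
      have h3 := apply_mem_of_mem_smul_top q hd
      have : D (x + d) - D x = polar q z d + s * (q d + polar q x d) := by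
        simp only [D, QuadraticMap.map_add q, polar_add_right]
        ring
      rw [this]
      exact m.add_mem h1 (m.mul_mem_left _ (m.add_mem h3 h2))
    · by_cases hsm : s ∈ m
      · have hz2 : q z ∈ m ^ 2 := hz ▸ Ideal.mul_mem_right _ _ (Ideal.pow_mem_pow hsm 2)
        have : ∃ v, polar q z v ∉ m := by
          by_contra! h
          exact hq.not_mem_sq m z (hs m hsm) h hz2
        obtain ⟨v, hv⟩ := this
        refine ⟨v, fun h => hv ?_⟩
        have : polar q z v = D v - s * (u + q v) := by
          simp only [D]
          ring
        rw [this]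
        exact m.sub_mem h (m.mul_mem_right _ hsm)
      -- Here `w` is integral at `m`, and `t ≡ w` gives `q (w + t) ≡ 4 * u`.
      · obtain ⟨c, i, hi, hci⟩ := hm.exists_inv hsm
        refine ⟨c • z, fun h => ?_⟩
        have hsD : s * D (c • z) = (2 - i) ^ 2 * (s ^ 2 * u) := by
          have : s * D (c • z) = (1 + c * s) ^ 2 * (s ^ 2 * u) := by
            simp only [D, polar_smul_right, polar_self, QuadraticMap.map_smul, hz, smul_eq_mul]
            ring
          rw [this, show 1 + c * s = 2 - i by linear_combination hci]
        have h2 : (2 - i) ^ 2 * (s ^ 2 * u) ∈ m := hsD ▸ m.mul_mem_left _ h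
        have hu' : u ∉ m := fun h => hm.ne_top (Ideal.eq_top_of_isUnit_mem _ h hu)
        rcases hm.isPrime.mem_or_mem h2 with h3 | h3
        · have h4 := m.add_mem (hm.isPrime.mem_of_pow_mem _ h3) hi
          rw [sub_add_cancel] at h4
          exact hm.ne_top (Ideal.eq_top_of_isUnit_mem _ h4 (isUnit_of_invertible 2))
        · rcases hm.isPrime.mem_or_mem h3 with h4 | h4
          · exact hsm (hm.isPrime.mem_of_pow_mem _ h4)
          · exact hu' h4
  -- The image of `w` under the reflection in `w + t`, up to sign.
  refine ⟨t + ((u - q t) * ↑d⁻¹) • (z + s • t), ?_⟩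
  have hinv : (↑d⁻¹ : R) * (s * u + polar q z t + s * q t) = 1 := by
    change (↑d⁻¹ : R) * D t = 1
    rw [← hd, Units.inv_mul]
  have hpol : polar q t (z + s • t) = polar q z t + 2 * s * q t := by
    rw [polar_add_right, polar_smul_right, polar_self, polar_comm]
    simp only [smul_eq_mul, two_nsmul]
    ring
  rw [apply_add_smul, hpol, apply_add_smul, hz]
  linear_combination ((u - q t) + (u - q t) ^ 2 * ↑d⁻¹ * s) * hinv

end Reduced

/-! ### Orthogonal complement of a vector of unit norm -/

section Orthogonal

variable {R : Type*} [CommRing R] {L : Type*} [AddCommGroup L] [Module R L]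

theorem apply_smul_add_orthogonal (q : QuadraticForm R L) {x : L} (c : R)
    (y : LinearMap.ker (q.polarBilin x)) : q (c • x + y) = c ^ 2 * q x + q y := by
  have h : polar q (y : L) x = 0 := (polar_comm q _ _).trans (LinearMap.mem_ker.1 y.2)
  rw [add_comm, apply_add_smul, h]
  ring

variable [Invertible (2 : R)]

/-- A vector on which `q` takes a unit value spans an orthogonal direct summand. -/
theorem exists_prod_orthogonal_equiv (q : QuadraticForm R L) {x : L} (hx : IsUnit (q x)) :
    ∃ e : (R × LinearMap.ker (q.polarBilin x)) ≃ₗ[R] L, ∀ p, e p = p.1 • x + (p.2 : L) := by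
  obtain ⟨u, hu⟩ := hx
  let f : (R × LinearMap.ker (q.polarBilin x)) →ₗ[R] L :=
    (LinearMap.toSpanSingleton R L x).coprod (Submodule.subtype _)
  have hf : ∀ p, f p = p.1 • x + (p.2 : L) := fun p => by simp [f]
  have hxx : q.polarBilin x x = 2 * u := by
    rw [polarBilin_apply_apply, polar_self, two_nsmul, hu, two_mul]
  have hfx : ∀ p, q.polarBilin x (f p) = p.1 * (2 * u) := fun p => by
    rw [hf, map_add, map_smul, LinearMap.mem_ker.1 p.2.2, hxx, add_zero, smul_eq_mul]
  refine ⟨LinearEquiv.ofBijective f ⟨?_, fun l => ?_⟩, hf⟩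
  · rw [← LinearMap.ker_eq_bot, LinearMap.ker_eq_bot']
    intro p hp
    have h1 := hfx p
    rw [hp, map_zero] at h1
    have h2 : p.1 = 0 := by
      have := congrArg (fun a => a * (⅟2 * ↑u⁻¹ : R)) h1.symm
      have h3 : p.1 * (2 * (u : R)) * (⅟2 * ↑u⁻¹ : R) = p.1 := by
        linear_combination p.1 * (u : R) * ↑u⁻¹ * (mul_invOf_self (2 : R)) + p.1 * u.mul_inv
      simpa [h3] using this
    have h3 := hf p
    rw [hp, h2, zero_smul, zero_add] at h3
    exact Prod.ext h2 (Subtype.ext h3.symm)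
  · refine ⟨(q.polarBilin x l * (⅟2 * ↑u⁻¹),
      ⟨l - (q.polarBilin x l * (⅟2 * ↑u⁻¹)) • x, ?_⟩), ?_⟩
    · rw [LinearMap.mem_ker, map_sub, map_smul, hxx, smul_eq_mul]
      linear_combination (-q.polarBilin x l * (u : R) * ↑u⁻¹) * (mul_invOf_self (2 : R))
        - q.polarBilin x l * u.mul_inv
    · rw [hf]
      exact add_sub_cancel _ _

theorem HasReducedDegeneration.orthogonal {q : QuadraticForm R L} (hq : q.HasReducedDegeneration)
    {x : L} (hx : IsUnit (q x)) :
    HasReducedDegeneration (q.comp (LinearMap.ker (q.polarBilin x)).subtype) := by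
  obtain ⟨e, he⟩ := exists_prod_orthogonal_equiv q hx
  have hproj : ∀ y : LinearMap.ker (q.polarBilin x), (e.symm (y : L)).2 = y := fun y => by
    rw [show (y : L) = e (0, y) by simp [he], e.symm_apply_apply]
  have hsmul : ∀ (m : Ideal R) (y : LinearMap.ker (q.polarBilin x)),
      (y : L) ∈ m • (⊤ : Submodule R L) → y ∈ m • (⊤ : Submodule R _) := fun m y hy => by
    have := Submodule.smul_top_le_comap_smul_top m
      ((LinearMap.snd R R (LinearMap.ker (q.polarBilin x))) ∘ₗ e.symm.toLinearMap) hy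
    simpa [hproj] using this
  have hpol : ∀ (m : Ideal R) (y : LinearMap.ker (q.polarBilin x)),
      (∀ v, polar (q.comp (LinearMap.ker (q.polarBilin x)).subtype) y v ∈ m) →
      ∀ v, polar q (y : L) v ∈ m := fun m y hy v => by
    obtain ⟨p, rfl⟩ := e.surjective v
    have h : polar q (y : L) x = 0 := (polar_comm q _ _).trans (LinearMap.mem_ker.1 y.2)
    rw [he, polar_add_right, polar_smul_right, h, smul_zero, zero_add]
    exact hy p.2
  refine ⟨fun m _ y z hy hz => ?_, fun m _ y hy hyv => ?_⟩
  · obtain ⟨a, b, hab, h⟩ := hq.dependent m y z (hpol m y hy) (hpol m z hz)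
    exact ⟨a, b, hab, hsmul m _ (by simpa using h)⟩
  · refine hq.not_mem_sq m (y : L) (fun h => hy (hsmul m y h)) (hpol m y hyv)

end Orthogonal

/-! ### Reflections over a field -/

section Field

variable {K : Type*} [Field K] {W : Type*} [AddCommGroup W] [Module K W]

theorem exists_reflection (Q : QuadraticForm K W) {v : W} (hv : Q v ≠ 0) :
    ∃ σ : W ≃ₗ[K] W, (∀ w, Q (σ w) = Q w) ∧ ∀ w, σ w = w - (polar Q v w / Q v) • v := by
  have h : ((Q v)⁻¹ • Q.polarBilin v) v = 2 := by
    rw [LinearMap.smul_apply, polarBilin_apply_apply, polar_self, smul_eq_mul, two_nsmul]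
    field_simp
    ring
  have hσ : ∀ w, Module.reflection h w = w - (polar Q v w / Q v) • v := fun w => by
    rw [Module.reflection_apply, LinearMap.smul_apply, polarBilin_apply_apply, smul_eq_mul,
      div_eq_inv_mul]
  refine ⟨Module.reflection h, fun w => ?_, hσ⟩
  rw [hσ, sub_eq_add_neg, ← neg_smul, apply_add_smul, polar_comm Q w v]
  field_simp
  ring

/-- Two vectors of the same nonzero norm are conjugate under the orthogonal group: one of their
sum and difference is anisotropic, and the reflection in it maps one to the other up to sign. -/
theorem exists_isometry_apply_eq [Invertible (2 : K)] (Q : QuadraticForm K W) {a b : W}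
    (hab : Q a = Q b) (ha : Q a ≠ 0) : ∃ σ : W ≃ₗ[K] W, (∀ w, Q (σ w) = Q w) ∧ σ a = b := by
  have h2 : (2 : K) ≠ 0 := (isUnit_of_invertible (2 : K)).ne_zero
  have hsub : Q (a - b) = 2 * Q a - polar Q a b := by
    rw [sub_eq_add_neg, QuadraticMap.map_add Q, polar_neg_right, QuadraticMap.map_neg, ← hab]
    ring
  have hadd : Q (a + b) = 2 * Q a + polar Q a b := by
    rw [QuadraticMap.map_add Q, ← hab]
    ring
  by_cases h : Q (a - b) = 0
  · have hne : Q (a + b) ≠ 0 := fun h' => by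
      have : 2 * (2 * Q a) = 0 := by linear_combination h' + h - hadd - hsub
      simp [h2, ha] at this
    obtain ⟨σ, hσ, hσ'⟩ := exists_reflection Q hne
    refine ⟨σ.trans (LinearEquiv.neg K), fun w => ?_, ?_⟩
    · simp [hσ]
    · have : polar Q (a + b) a / Q (a + b) = 1 := by
        rw [div_eq_one_iff_eq hne, polar_add_left, polar_self, polar_comm Q b a, hadd, two_nsmul,
          two_mul]
      rw [LinearEquiv.trans_apply, hσ', this, one_smul, LinearEquiv.neg_apply]
      abel
  · obtain ⟨σ, hσ, hσ'⟩ := exists_reflection Q h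
    refine ⟨σ, hσ, ?_⟩
    have : polar Q (a - b) a / Q (a - b) = 1 := by
      rw [div_eq_one_iff_eq h, polar_sub_left, polar_self, polar_comm Q b a, hsub, two_nsmul,
        two_mul]
    rw [hσ', this, one_smul, sub_sub_cancel]

end Field

/-! ### Lattices in a quadratic space -/

section Lattice

variable {R : Type*} [CommRing R] {K : Type*} [Field K] [Algebra R K]
  {L : Type*} [AddCommGroup L] [Module R L]
  {W : Type*} [AddCommGroup W] [Module K W] [Module R W]

/-- The map `i` presents `(L, q)` as a lattice in the quadratic space `(W, Q)`. Injectivity of `i`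
is not part of the definition. -/
structure IsLattice (Q : QuadraticForm K W) (q : QuadraticForm R L) (i : L →ₗ[R] W) : Prop where
  apply_map : ∀ x, Q (i x) = algebraMap R K (q x)
  exists_map_eq_smul : ∀ w, ∃ s : R, s ≠ 0 ∧ ∃ x, i x = s • w

namespace IsLattice

variable {Q : QuadraticForm K W} {q : QuadraticForm R L} {i : L →ₗ[R] W}

theorem polar_map (h : IsLattice Q q i) (x y : L) :
    polar Q (i x) (i y) = algebraMap R K (polar q x y) := by
  simp [polar, ← map_add, h.apply_map, map_sub]

variable [IsScalarTower R K W]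

theorem comp_isometry {W₁ : Type*} [AddCommGroup W₁] [Module K W₁] [Module R W₁]
    [IsScalarTower R K W₁] {Q₁ : QuadraticForm K W₁} (h : IsLattice Q q i) {σ : W ≃ₗ[K] W₁}
    (hσ : ∀ w, Q₁ (σ w) = Q w) :
    IsLattice Q₁ q ((σ.toLinearMap.restrictScalars R) ∘ₗ i) := by
  refine ⟨fun x => (hσ _).trans (h.apply_map x), fun w => ?_⟩
  obtain ⟨s, hs, x, hx⟩ := h.exists_map_eq_smul (σ.symm w)
  refine ⟨s, hs, x, ?_⟩
  have : σ (i x) = s • w := by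
    rw [hx, ← algebraMap_smul K s, map_smul, σ.apply_symm_apply, algebraMap_smul]
  exact this

variable [IsFractionRing R K]

theorem exists_orthogonal (h : IsLattice Q q i) {x : L} {w : W} (hw : i x = w) :
    ∃ j : LinearMap.ker (q.polarBilin x) →ₗ[R] LinearMap.ker (Q.polarBilin w),
      IsLattice (Q.comp (LinearMap.ker (Q.polarBilin w)).subtype)
        (q.comp (LinearMap.ker (q.polarBilin x)).subtype) j := by
  subst hw
  have hj : ∀ y : LinearMap.ker (q.polarBilin x), i y ∈ LinearMap.ker (Q.polarBilin (i x)) :=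
    fun y => by
      have hy : polar q x y = 0 := LinearMap.mem_ker.1 y.2
      rw [LinearMap.mem_ker, polarBilin_apply_apply, h.polar_map, hy, map_zero]
  refine ⟨{ toFun := fun y => ⟨i y, hj y⟩
            map_add' := fun y z => Subtype.ext (map_add i (y : L) z)
            map_smul' := fun c y => Subtype.ext (map_smul i c (y : L)) },
    fun y => h.apply_map y, fun w => ?_⟩
  obtain ⟨s, hs, y, hy⟩ := h.exists_map_eq_smul (w : W)
  have hxy : polar q x y = 0 := by
    apply IsFractionRing.injective R K
    have hxw : Q.polarBilin (i x) w = 0 := LinearMap.mem_ker.1 w.2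
    rw [← h.polar_map, hy, ← algebraMap_smul K s, ← polarBilin_apply_apply, map_smul, hxw,
      smul_zero, map_zero]
  exact ⟨s, hs, ⟨y, LinearMap.mem_ker.2 hxy⟩, Subtype.ext hy⟩

/-- Every vector of `W` is a fraction in lowest terms: the numerator `z` is nonzero modulo every
maximal ideal that contains the denominator `s`. -/
theorem exists_primitive [IsDomain R] [IsPrincipalIdealRing R] (h : IsLattice Q q i) (w : W) :
    ∃ (s : R) (z : L), s ≠ 0 ∧ i z = s • w ∧
      ∀ (m : Ideal R) [m.IsMaximal], s ∈ m → z ∉ m • (⊤ : Submodule R L) := by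
  -- The denominator generates the ideal of all denominators of `w`.
  let I : Ideal R := Submodule.comap (LinearMap.toSpanSingleton R W w) (LinearMap.range i)
  have hI : ∀ r, r ∈ I ↔ ∃ z, i z = r • w := fun r => by simp [I]
  obtain ⟨s, hs⟩ := IsPrincipalIdealRing.principal I
  have hmem : ∀ r, r ∈ I ↔ s ∣ r := fun r => by
    rw [hs]
    exact Ideal.mem_span_singleton
  obtain ⟨z, hz⟩ := (hI s).1 ((hmem s).2 dvd_rfl)
  have hs0 : s ≠ 0 := by
    rintro rfl
    obtain ⟨r, hr, x, hx⟩ := h.exists_map_eq_smul w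
    exact hr (zero_dvd_iff.1 ((hmem r).1 ((hI r).2 ⟨x, hx⟩)))
  refine ⟨s, z, hs0, hz, fun m hm hsm hzm => ?_⟩
  obtain ⟨p, hp⟩ := IsPrincipalIdealRing.principal m
  change m = Ideal.span {p} at hp
  obtain ⟨c, rfl⟩ := Ideal.mem_span_singleton.1 (hp ▸ hsm)
  rw [hp, Submodule.ideal_span_singleton_smul] at hzm
  obtain ⟨z', -, rfl⟩ := Submodule.mem_smul_pointwise_iff_exists _ _ _ |>.1 hzm
  have hp0 : algebraMap R K p ≠ 0 :=
    (map_ne_zero_iff _ (IsFractionRing.injective R K)).2 (left_ne_zero_of_mul hs0)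
  have hz' : i z' = c • w := by
    rw [map_smul, mul_smul, ← algebraMap_smul K p, ← algebraMap_smul K p (c • w)] at hz
    exact smul_right_injective W hp0 hz
  obtain ⟨d, hd⟩ := (hmem c).1 ((hI c).2 ⟨z', hz'⟩)
  have hc0 : c ≠ 0 := right_ne_zero_of_mul hs0
  have hpd : p * d = 1 := mul_left_cancel₀ hc0 (by linear_combination -hd)
  exact hm.ne_top (hp ▸ Ideal.span_singleton_eq_top.2 (IsUnit.of_mul_eq_one _ hpd))

end IsLattice

end Lattice

/-! ### Isometry of lattices in the same quadratic space -/

section Classification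

variable {R : Type*} [CommRing R] {K : Type*} [Field K] [Algebra R K] [IsFractionRing R K]

theorem IsLattice.apply_eq_of_map_eq_smul
    {L : Type*} [AddCommGroup L] [Module R L] {L' : Type*} [AddCommGroup L'] [Module R L']
    {W : Type*} [AddCommGroup W] [Module K W] [Module R W] [IsScalarTower R K W]
    {Q : QuadraticForm K W} {q : QuadraticForm R L} {q' : QuadraticForm R L'}
    {i : L →ₗ[R] W} {i' : L' →ₗ[R] W} (hi : IsLattice Q q i) (hi' : IsLattice Q q' i')
    {s : R} {x : L} {z : L'} (hz : i' z = s • i x) : q' z = s ^ 2 * q x := by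
  apply IsFractionRing.injective R K
  rw [← hi'.apply_map, hz, ← algebraMap_smul K s, QuadraticMap.map_smul, hi.apply_map,
    smul_eq_mul, map_mul, map_pow, pow_two]

variable [IsDomain R] [IsPrincipalIdealRing R]

/-- A generator of `L` is `c / s` times a generator of `L'` in lowest terms. A prime factor of `s`
would divide the norm of the generator of `L'` twice, and one of `c` that of the generator of `L`,
so both are units. -/
theorem equivalent_of_isLattice_of_finrank_eq_one
    {L : Type*} [AddCommGroup L] [Module R L] [Module.Free R L]
    {L' : Type*} [AddCommGroup L'] [Module R L'] [Module.Free R L']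
    {W : Type*} [AddCommGroup W] [Module K W] [Module R W] [IsScalarTower R K W]
    {Q : QuadraticForm K W} {q : QuadraticForm R L} {q' : QuadraticForm R L'}
    {i : L →ₗ[R] W} {i' : L' →ₗ[R] W} (hi : IsLattice Q q i) (hi' : IsLattice Q q' i')
    (hq : q.HasReducedDegeneration) (hq' : q'.HasReducedDegeneration)
    (hL : Module.finrank R L = 1) (hL' : Module.finrank R L' = 1) : q.Equivalent q' := by
  let b := Module.basisUnique Unit hL
  let b' := Module.basisUnique Unit hL'
  obtain ⟨s, z, -, hz, hprim⟩ := hi'.exists_primitive (i (b ()))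
  have hgen : ∀ y, y = b.repr y () • b () := fun y => by
    simpa using (b.sum_repr y).symm
  have hgen' : ∀ y, y = b'.repr y () • b' () := fun y => by
    simpa using (b'.sum_repr y).symm
  obtain ⟨c, hc⟩ : ∃ c : R, z = c • b' () := ⟨_, hgen' z⟩
  have hqz : q' z = s ^ 2 * q (b ()) := hi.apply_eq_of_map_eq_smul hi' hz
  have hqz' : q' z = c ^ 2 * q' (b' ()) := by
    rw [hc, QuadraticMap.map_smul, smul_eq_mul, pow_two]
  have hs : IsUnit s := by
    by_contra hs
    obtain ⟨m, hm, hsm⟩ := exists_max_ideal_of_mem_nonunits hs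
    have hzm := hprim m hsm
    have hcm : c ∉ m := fun h => hzm (hc ▸ Submodule.smul_mem_smul h Submodule.mem_top)
    have hsq : q' z ∈ m ^ 2 := hqz ▸ Ideal.mul_mem_right _ _ (Ideal.pow_mem_pow hsm 2)
    have hm' : q' (b' ()) ∈ m :=
      (hm.isPrime.mem_or_mem (hqz' ▸ Ideal.pow_le_self two_ne_zero hsq)).resolve_left
        fun h => hcm (hm.isPrime.mem_of_pow_mem _ h)
    refine hq'.not_mem_sq m z hzm (fun v => ?_) hsq
    rw [hc, hgen' v, polar_smul_left, polar_smul_right, polar_self, two_nsmul]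
    exact m.mul_mem_left _ (m.mul_mem_left _ (m.add_mem hm' hm'))
  have hcu : IsUnit c := by
    by_contra hcu
    obtain ⟨m, hm, hcm⟩ := exists_max_ideal_of_mem_nonunits hcu
    have hsq : q (b ()) ∈ m ^ 2 := by
      refine (Ideal.unit_mul_mem_iff_mem _ (hs.pow 2)).1 ?_
      rw [← hqz, hqz']
      exact Ideal.mul_mem_right _ _ (Ideal.pow_mem_pow hcm 2)
    refine hq.not_mem_sq m (b ()) (fun h => ?_) (fun v => ?_) hsq
    · have := linearMap_apply_mem_of_mem_smul_top (b.coord ()) h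
      rw [b.coord_apply, b.repr_self, Finsupp.single_eq_same] at this
      exact hm.ne_top ((Ideal.eq_top_iff_one _).2 this)
    · have hm' := Ideal.pow_le_self two_ne_zero hsq
      rw [hgen v, polar_smul_right, polar_self, two_nsmul]
      exact m.mul_mem_left _ (m.add_mem hm' hm')
  obtain ⟨s, rfl⟩ := hs
  obtain ⟨c, rfl⟩ := hcu
  refine ⟨⟨b.equiv (b'.unitsSMul fun _ => s⁻¹ * c) (Equiv.refl _), fun y => ?_⟩⟩
  change q' (b.equiv (b'.unitsSMul fun _ => s⁻¹ * c) (Equiv.refl _) y) = q y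
  rw [hgen y, _root_.map_smul, b.equiv_apply, QuadraticMap.map_smul q', QuadraticMap.map_smul q]
  congr 1
  rw [Equiv.refl_apply, Module.Basis.unitsSMul_apply, Units.smul_def, QuadraticMap.map_smul,
    smul_eq_mul]
  have h := hqz.symm.trans hqz'
  rw [Units.val_mul]
  linear_combination (-(↑s⁻¹ : R) ^ 2) * h + (s * ↑s⁻¹ + 1) * q (b ()) * s.mul_inv

/-- Induction on the rank: two lattices in the same quadratic space represent a common unit, which
splits off from both of them, and from the space by Witt cancellation. -/
theorem equivalent_of_isLattice [Finite (MaximalSpectrum R)] [Invertible (2 : R)] (n : ℕ) :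
    ∀ {L : Type u} [AddCommGroup L] [Module R L] [Module.Free R L] [Module.Finite R L]
      {L' : Type v} [AddCommGroup L'] [Module R L'] [Module.Free R L'] [Module.Finite R L']
      {W : Type w} [AddCommGroup W] [Module K W] [Module R W] [IsScalarTower R K W]
      {Q : QuadraticForm K W} {q : QuadraticForm R L} {q' : QuadraticForm R L'}
      {i : L →ₗ[R] W} {i' : L' →ₗ[R] W}, IsLattice Q q i → IsLattice Q q' i' →
      q.HasReducedDegeneration → q'.HasReducedDegeneration →
      Module.finrank R L = n → Module.finrank R L' = n → q.Equivalent q' := by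
  induction n with
  | zero =>
    intro L _ _ _ _ L' _ _ _ _ W _ _ _ _ Q q q' i i' _ _ _ _ hL hL'
    have := Module.finrank_zero_iff.1 hL
    exact ⟨⟨LinearEquiv.ofFinrankEq L L' (hL.trans hL'.symm), fun y => by
      rw [Subsingleton.elim y 0]
      exact (congrArg q' (map_zero (LinearEquiv.ofFinrankEq L L' _))).trans
        ((QuadraticMap.map_zero q').trans (QuadraticMap.map_zero q).symm)⟩⟩
  | succ n ih =>
    intro L _ _ _ _ L' _ _ _ _ W _ _ _ _ Q q q' i i' hi hi' hq hq' hL hL'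
    rcases n.eq_zero_or_pos with rfl | hn
    · exact equivalent_of_isLattice_of_finrank_eq_one hi hi' hq hq' hL hL'
    obtain ⟨x, hx⟩ := exists_isUnit_apply hq (by lia)
    obtain ⟨s, z, -, hz, hprim⟩ := hi'.exists_primitive (i x)
    have hqz : q' z = s ^ 2 * q x := hi.apply_eq_of_map_eq_smul hi' hz
    obtain ⟨y, hy⟩ := exists_apply_eq hq' hx hqz hprim
    have hQ : Q (i x) = Q (i' y) := by rw [hi.apply_map, hi'.apply_map, hy]
    have hQ0 : Q (i x) ≠ 0 := by
      rw [hi.apply_map]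
      exact (hx.map (algebraMap R K)).ne_zero
    let : Invertible (2 : K) := (Invertible.map (algebraMap R K) 2).copy 2 (map_ofNat _ _).symm
    obtain ⟨σ, hσ, hσx⟩ := exists_isometry_apply_eq Q hQ hQ0
    obtain ⟨j, hj⟩ := (hi.comp_isometry hσ).exists_orthogonal (x := x) (w := i' y) hσx
    obtain ⟨j', hj'⟩ := hi'.exists_orthogonal (x := y) (w := i' y) rfl
    obtain ⟨e, he⟩ := exists_prod_orthogonal_equiv q hx
    obtain ⟨e', he'⟩ := exists_prod_orthogonal_equiv q' (hy ▸ hx)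
    have hrank : Module.finrank R (LinearMap.ker (q.polarBilin x)) = n := by
      have := e.finrank_eq
      rw [Module.finrank_prod, Module.finrank_self] at this
      lia
    have hrank' : Module.finrank R (LinearMap.ker (q'.polarBilin y)) = n := by
      have := e'.finrank_eq
      rw [Module.finrank_prod, Module.finrank_self] at this
      lia
    obtain ⟨f⟩ := ih hj hj' (hq.orthogonal hx) (hq'.orthogonal (hy ▸ hx)) hrank hrank'
    refine ⟨⟨e.symm ≪≫ₗ ((LinearEquiv.refl R R).prodCongr f.toLinearEquiv) ≪≫ₗ e', fun l => ?_⟩⟩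
    obtain ⟨p, rfl⟩ := e.surjective l
    change q' (e' (((LinearEquiv.refl R R).prodCongr f.toLinearEquiv) (e.symm (e p)))) = q (e p)
    have hf : q' (f p.2) = q p.2 := f.map_app p.2
    rw [e.symm_apply_apply, he, he', apply_smul_add_orthogonal, apply_smul_add_orthogonal, hy,
      ← hf]
    rfl

end Classification

/-! ### Residue fields and localizations -/

section BaseChange

theorem exists_smul_add_smul_eq_zero {k W : Type*} [Field k] [AddCommGroup W] [Module k W]
    [Module.Finite k W] {S : Submodule k W} (hS : Module.finrank k S ≤ 1) {x y : W} (hx : x ∈ S)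
    (hy : y ∈ S) : ∃ a b : k, (a ≠ 0 ∨ b ≠ 0) ∧ a • x + b • y = 0 := by
  obtain ⟨v, hv⟩ := finrank_le_one_iff.1 hS
  obtain ⟨a, ha⟩ := hv ⟨x, hx⟩
  obtain ⟨b, hb⟩ := hv ⟨y, hy⟩
  have ha' : a • (v : W) = x := congrArg Subtype.val ha
  have hb' : b • (v : W) = y := congrArg Subtype.val hb
  by_cases h : a = 0
  · exact ⟨1, 0, Or.inl one_ne_zero, by rw [← ha', h, zero_smul, smul_zero, zero_smul, add_zero]⟩
  · exact ⟨-b, a, Or.inr h, by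
      rw [← ha', ← hb', smul_smul, smul_smul, mul_comm a b, neg_mul, neg_smul, neg_add_cancel]⟩

variable {R : Type*} [CommRing R] {V : Type*} [AddCommGroup V] [Module R V]

theorem polar_weightedSumSquares_single {A : Type*} [CommRing A] {ι : Type*} [Fintype ι]
    [DecidableEq ι] (w x : ι → A) (k : ι) :
    polar (weightedSumSquares A w) x (Pi.single k 1) = 2 * w k * x k := by
  simp only [polar, weightedSumSquares_apply, ← Finset.sum_sub_distrib, smul_eq_mul, Pi.add_apply]
  rw [Finset.sum_eq_single k]
  · simp
    ring
  · intro l _ hl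
    simp [Pi.single_eq_of_ne hl]
  · simp

theorem mem_smul_top_of_tmul_mem_smul_top (A : Type*) [CommRing A] [Algebra R A]
    [Module.Free R V] {I : Ideal R} {J : Ideal A}
    (hIJ : J.comap (algebraMap R A) ≤ I) {x : V}
    (hx : (1 : A) ⊗ₜ[R] x ∈ J • (⊤ : Submodule A (A ⊗[R] V))) :
    x ∈ I • (⊤ : Submodule R V) := by
  let b := Module.Free.chooseBasis R V
  rw [← b.linearCombination_repr x, Finsupp.linearCombination_apply]
  refine Submodule.sum_mem _ fun k _ => Submodule.smul_mem_smul (hIJ ?_) Submodule.mem_top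
  have h := linearMap_apply_mem_of_mem_smul_top ((b.baseChange A).coord k) hx
  rwa [Module.Basis.coord_apply, Module.Basis.baseChange_repr_tmul, Algebra.smul_def,
    mul_one] at h

theorem comap_bot_residueField (m : Ideal R) [m.IsPrime] :
    (⊥ : Ideal m.ResidueField).comap (algebraMap R m.ResidueField) ≤ m := fun _ h =>
  Ideal.algebraMap_residueField_eq_zero.1 (Ideal.mem_bot.1 (Ideal.mem_comap.1 h))

variable [Invertible (2 : R)]

theorem isLattice_baseChange (K : Type*) [Field K] [Algebra R K] [IsFractionRing R K]
    [Nontrivial R] (q : QuadraticForm R V) :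
    IsLattice (q.baseChange K) q (TensorProduct.mk R K V 1) := by
  refine ⟨fun x => ?_, fun w => ?_⟩
  · rw [TensorProduct.mk_apply, baseChange_tmul, mul_one, Algebra.smul_def, mul_one]
  · obtain ⟨⟨x, s⟩, h⟩ := IsLocalizedModule.surj (nonZeroDivisors R) (TensorProduct.mk R K V 1) w
    exact ⟨s, nonZeroDivisors.coe_ne_zero s, x, h.symm⟩

variable (A : Type*) [CommRing A] [Algebra R A]

theorem polar_baseChange_mem (q : QuadraticForm R V) {J : Ideal A} {x : V}
    (h : ∀ v, algebraMap R A (polar q x v) ∈ J) (y : A ⊗[R] V) :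
    polar (q.baseChange A) (1 ⊗ₜ x) y ∈ J := by
  let : Invertible (2 : A) := (Invertible.map (algebraMap R A) 2).copy 2 (map_ofNat _ _).symm
  induction y with
  | zero => simp
  | add y z hy hz => exact polar_add_right (q.baseChange A) _ y z ▸ J.add_mem hy hz
  | tmul a v =>
    rw [← polarBilin_apply_apply, polarBilin_baseChange, LinearMap.BilinForm.baseChange_tmul,
      polarBilin_apply_apply, Algebra.smul_def]
    exact J.mul_mem_right _ (h v)

theorem one_tmul_mem_fiberRadical {q : QuadraticForm R V} {m : Ideal R} [m.IsPrime] {x : V}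
    (hx : ∀ v, polar q x v ∈ m) : (1 : m.ResidueField) ⊗ₜ x ∈ q.fiberRadical m :=
  LinearMap.mem_ker.2 <| LinearMap.ext fun y => (Submodule.mem_bot _).1 <|
    polar_baseChange_mem m.ResidueField q (J := ⊥)
      (fun v => (Submodule.mem_bot _).2 (Ideal.algebraMap_residueField_eq_zero.2 (hx v))) y

/-- The residue field at `m` is a quotient of `R`, so that a linear dependence in the fiber lifts. -/
theorem HasSimpleDegeneration.dependent [Module.Free R V] [Module.Finite R V]
    {q : QuadraticForm R V} (hq : q.HasSimpleDegeneration) (m : Ideal R) [m.IsMaximal] (x y : V)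
    (hx : ∀ v, polar q x v ∈ m) (hy : ∀ v, polar q y v ∈ m) :
    ∃ a b : R, (a ∉ m ∨ b ∉ m) ∧ a • x + b • y ∈ m • (⊤ : Submodule R V) := by
  obtain ⟨s, t, hne, hst⟩ := exists_smul_add_smul_eq_zero (hq m) (one_tmul_mem_fiberRadical hx)
    (one_tmul_mem_fiberRadical hy)
  obtain ⟨a, rfl⟩ := m.algebraMap_residueField_surjective s
  obtain ⟨b, rfl⟩ := m.algebraMap_residueField_surjective t
  refine ⟨a, b, ?_, ?_⟩
  · exact hne.imp (fun h h' => h (Ideal.algebraMap_residueField_eq_zero.2 h'))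
      (fun h h' => h (Ideal.algebraMap_residueField_eq_zero.2 h'))
  · refine mem_smul_top_of_tmul_mem_smul_top m.ResidueField (comap_bot_residueField m) ?_
    have h : (1 : m.ResidueField) ⊗ₜ[R] (a • x + b • y) = 0 := by
      rw [TensorProduct.tmul_add, TensorProduct.tmul_smul, TensorProduct.tmul_smul,
        ← algebraMap_smul m.ResidueField a, ← algebraMap_smul m.ResidueField b]
      exact hst
    rw [h]
    exact Submodule.zero_mem _

/-- If the last coefficient of the diagonalization is a uniformizer times a unit, then a vector in
the radical modulo `m` has all other coordinates in the maximal ideal of the localization, so that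
such a vector, if nonzero modulo `m`, has a value of valuation one. -/
theorem HasMultiplicityOne.not_mem_sq [IsDomain R] [IsPrincipalIdealRing R] [Module.Free R V]
    {q : QuadraticForm R V} (hq : q.HasMultiplicityOne) (m : Ideal R) [m.IsMaximal] (x : V)
    (hxm : x ∉ m • (⊤ : Submodule R V)) (hx : ∀ v, polar q x v ∈ m) : q x ∉ m ^ 2 := by
  intro hqx
  have hrad : q.fiberRadical m ≠ ⊥ := fun h => by
    have h0 := one_tmul_mem_fiberRadical hx
    rw [h, Submodule.mem_bot] at h0
    refine hxm (mem_smul_top_of_tmul_mem_smul_top m.ResidueField (comap_bot_residueField m) ?_)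
    rw [h0]
    exact Submodule.zero_mem _
  obtain ⟨n, u, c, π, hπ, ⟨e⟩⟩ := hq m hrad
  let A := Localization.AtPrime m
  -- The zero ideal is excluded because then the localization is a field, without uniformizers.
  have hm : m ≠ ⊥ := fun h => by
    have h' := (IsLocalization.AtPrime.map_eq_maximalIdeal m A).symm
    subst h
    rw [Ideal.map_bot] at h'
    exact hπ.ne_zero (Ideal.mem_bot.1 (h' ▸ (IsLocalRing.mem_maximalIdeal π).2 hπ.not_isUnit))
  have : IsDiscreteValuationRing A :=
    IsLocalization.AtPrime.isDiscreteValuationRing_of_dedekind_domain R hm A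
  set M := IsLocalRing.maximalIdeal A
  have hM : M = Ideal.span {π} := hπ.maximalIdeal_eq
  have hmap : ∀ r, algebraMap R A r ∈ M ↔ r ∈ m := fun r =>
    IsLocalization.AtPrime.to_map_mem_maximal_iff A m r
  let w : Fin (n + 1) → A := Fin.snoc (α := fun _ : Fin (n + 1) => A) (fun i : Fin n => (u i : A))
    ((c : A) * π ^ 1)
  have he : ∀ v, weightedSumSquares A w (e v) = q.baseChange A v := e.map_app
  let g : A ⊗[R] V := 1 ⊗ₜ x
  let y : Fin (n + 1) → A := e g
  have hpol : ∀ k, 2 * w k * y k ∈ M := fun k => by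
    have h := polar_baseChange_mem A q (fun v => (hmap _).2 (hx v))
      (e.toLinearEquiv.symm (Pi.single k 1))
    rw [← polar_weightedSumSquares_single]
    have hs : e (e.toLinearEquiv.symm (Pi.single k 1)) = Pi.single k 1 :=
      e.toLinearEquiv.apply_symm_apply _
    have ha : e (g + e.toLinearEquiv.symm (Pi.single k 1)) = y + Pi.single k 1 :=
      (map_add e.toLinearEquiv _ _).trans (congrArg (y + ·) hs)
    have hpolar : polar (weightedSumSquares A w) y (Pi.single k 1) =
        polar (q.baseChange A) g (e.toLinearEquiv.symm (Pi.single k 1)) := by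
      rw [polar, polar, ← he, ← he, ← he, ha, hs]
    exact hpolar ▸ h
  have hy : ∀ k : Fin n, y k.castSucc ∈ M := fun k => by
    have h := hpol k.castSucc
    have h2 : IsUnit (2 * w k.castSucc) := by
      have h2 : IsUnit (algebraMap R A 2) := (isUnit_of_invertible (2 : R)).map _
      rw [map_ofNat] at h2
      have hw : w k.castSucc = u k := Fin.snoc_castSucc _ _ _
      exact h2.mul (hw ▸ (u k).isUnit)
    exact (Ideal.unit_mul_mem_iff_mem _ h2).1 h
  have hlast : IsUnit (y (Fin.last n)) := by
    by_contra hl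
    refine hxm (mem_smul_top_of_tmul_mem_smul_top A (J := M) (fun r hr => (hmap r).1 hr) ?_)
    have hyM : y ∈ M • (⊤ : Submodule A (Fin (n + 1) → A)) := by
      rw [pi_eq_sum_univ' y]
      refine Submodule.sum_mem _ fun k _ => Submodule.smul_mem_smul ?_ Submodule.mem_top
      exact Fin.lastCases ((IsLocalRing.mem_maximalIdeal _).2 hl) hy k
    have h := Submodule.smul_top_le_comap_smul_top M e.toLinearEquiv.symm.toLinearMap hyM
    have hg : e.toLinearEquiv.symm y = g := e.toLinearEquiv.symm_apply_apply g
    change g ∈ _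
    rw [← hg]
    exact h
  have hval : q.baseChange A g ∈ M ^ 2 := by
    rw [baseChange_tmul, mul_one, Algebra.smul_def, mul_one]
    have h := Ideal.mem_map_of_mem (algebraMap R A) hqx
    rwa [Ideal.map_pow, IsLocalization.AtPrime.map_eq_maximalIdeal m A] at h
  have hsum : q.baseChange A g = (∑ k : Fin n, (u k : A) * (y k.castSucc * y k.castSucc)) +
      c * (y (Fin.last n) * y (Fin.last n)) * π := by
    rw [← he, weightedSumSquares_apply, Fin.sum_univ_castSucc]
    congr 1
    · refine Finset.sum_congr rfl fun k _ => ?_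
      rw [show w k.castSucc = u k from Fin.snoc_castSucc _ _ _]
      rfl
    · rw [show w (Fin.last n) = c * π ^ 1 from Fin.snoc_last _ _, smul_eq_mul]
      ring
  have hπM : π ∈ M ^ 2 := by
    rw [hsum, Ideal.add_mem_iff_right _ (Ideal.sum_mem _ fun k _ => Ideal.mul_mem_left _ _
      (pow_two M ▸ Ideal.mul_mem_mul (hy k) (hy k)))] at hval
    exact (Ideal.unit_mul_mem_iff_mem _ (c.isUnit.mul (hlast.mul hlast))).1 hval
  rw [hM, Ideal.span_singleton_pow, Ideal.mem_span_singleton] at hπM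
  obtain ⟨d, hd⟩ := hπM
  exact hπ.not_isUnit (IsUnit.of_mul_eq_one d
    (mul_left_cancel₀ hπ.ne_zero (by linear_combination -hd)))

end BaseChange

end QuadraticForm

open QuadraticForm in
theorem mainTheorem7
    {R : Type*} [CommRing R] [IsDomain R] [IsPrincipalIdealRing R]
    [Finite (MaximalSpectrum R)] [Invertible (2 : R)]
    (K : Type*) [Field K] [Algebra R K] [IsFractionRing R K]
    {V : Type*} [AddCommGroup V] [Module R V] [Module.Finite R V] [Module.Projective R V]
    {V' : Type*} [AddCommGroup V'] [Module R V'] [Module.Finite R V'] [Module.Projective R V']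
    (q : QuadraticForm R V) (q' : QuadraticForm R V')
    (hq : q.HasSimpleDegeneration) (hq_mult : q.HasMultiplicityOne)
    (hq' : q'.HasSimpleDegeneration) (hq'_mult : q'.HasMultiplicityOne)
    (hK : (q.baseChange K).Equivalent (q'.baseChange K)) :
    q.Equivalent q' := by
  obtain ⟨e⟩ := hK
  have hrank : Module.finrank R V = Module.finrank R V' := by
    rw [← Module.finrank_baseChange (R := K), ← Module.finrank_baseChange (R := K) (M' := V')]
    exact e.toLinearEquiv.finrank_eq
  exact equivalent_of_isLattice (Module.finrank R V')
    ((isLattice_baseChange K q).comp_isometry (σ := e.toLinearEquiv) e.map_app)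
    (isLattice_baseChange K q') ⟨hq.dependent, hq_mult.not_mem_sq⟩
    ⟨hq'.dependent, hq'_mult.not_mem_sq⟩ hrank rfl
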